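/- Let $K$ be a fixed number of job classes and $\mu_1,\dots,\mu_K>0$ fixed service rates. For each $n\ge 1$ consider the multi-server job queue with $n$ servers: class $i$ jobs arrive according to independent Poisson processes of rates $\lambda_i^{(n)}$; a class $i$ job needs $m_i^{(n)}$ servers simultaneously and holds them for an independent $\mathrm{Exp}(\mu_i)$ service time; jobs are served first-come-first-served with infinite queue capacity, so a job enters service when no older job is waiting and at least as many servers as it needs are idle. Thus the ordered list of the classes of all jobs in the system (oldest first) is a continuous-time Markov chain; let $X_i^{(n)}(t)$ be the number of class $i$ jobs in the system (waiting or in service) at time $t$. Assume that for all $i$ and all $n\ge1$ the class load is constant, $\frac{\lambda_i^{(n)}m_i^{(n)}}{n\mu_i}=\rho_i>0$, with $\rho=\sum_{i=1}^K\rho_i<1$; that $m_{\max}^{(n)}=\max_i m_i^{(n)}=o(n)$ as $n\to\infty$; and that for each $i$, $\frac{1}{\lambda_i^{(n)}}X_i^{(n)}(0)\to y_i(0)$ in probability as $n\to\infty$, where $(y_i(0))_i$ is deterministic with $0\le y_i(0)<\frac{1}{\rho\mu_i}$ for all $i$. Then the system of differential equations $$\dot y_i(t)=1-\min\Big\{\mu_i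 y_i(t),\frac1{\rho_i}\Big\},\qquad i=1,\dots,K,\ t\ge 0,$$ with initial condition $(y_i(0))_i$ has a unique solution $y(t)=(y_1(t),\dots,y_K(t))$ on $[0,\infty)$, this solution satisfies $\lim_{t\to\infty}y(t)=\big(\frac1{\mu_1},\dots,\frac1{\mu_K}\big)$, and for every fixed $T>0$, $$\lim_{n\to\infty}\ \sup_{0\le t\le T}\ \sum_{i=1}^K\left|\frac{1}{\lambda_i^{(n)}}X_i^{(n)}(t)-y_i(t)\right|=0\quad\text{in probability.}$$ -/

import Mathlib

open MeasureTheory Filter Topology Asymptotics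
open scoped NNReal ENNReal

/-- First-come-first-served allocation of `c` servers. A state is the list of the classes of all
jobs present, oldest first, and `m i` is the server need of a class-`i` job. Servers are handed out
in arrival order until a job does not fit; that job and all younger ones wait (head-of-queue
blocking). The value is the initial segment of the state made of the jobs in service. -/
def inService {K : ℕ} (m : Fin K → ℕ) : ℕ → List (Fin K) → List (Fin K)
  | _, [] => []
  | c, i :: u => if m i ≤ c then i :: inService m (c - m i) u else []

/-- Generator of the multi-server job queue with `n` servers, server needs `m`, arrival rates `lam`
and service rates `mu`: a class-`i` job arrives at rate `lam i` and joins the end of the list; the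
`j`-th oldest job, if it is in service and has class `i`, leaves the list at rate `mu i`. -/
noncomputable def queueGenerator {K : ℕ} (n : ℕ) (m : Fin K → ℕ) (lam mu : Fin K → ℝ)
    (f : List (Fin K) → ℝ) (u : List (Fin K)) : ℝ :=
  (∑ i : Fin K, lam i * (f (u ++ [i]) - f u)) +
    ∑ j : Fin (inService m n u).length,
      mu ((inService m n u).get j) * (f (u.eraseIdx j) - f u)

/-- `U` is a state process of the multi-server job queue: the continuous-time Markov chain on the
countable discrete set of finite lists of classes, with càdlàg paths and with the transition rates
in `queueGenerator`, expressed by the martingale problem for this generator. (When all server needs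
are positive, at most `n` jobs are in service, so the jump rates are bounded and the martingale
problem determines the law of `U` from that of `U 0`.) The initial state is arbitrary. -/
structure IsMultiserverJobProcess {K : ℕ} (n : ℕ) (m : Fin K → ℕ) (lam mu : Fin K → ℝ)
    {Ω : Type*} {mΩ : MeasurableSpace Ω} (P : Measure Ω) (F : Filtration ℝ≥0 mΩ)
    (U : ℝ≥0 → Ω → List (Fin K)) : Prop where
  adapted : ∀ t u, MeasurableSet[F t] {ω | U t ω = u}
  right_continuous : ∀ ω t, ∀ᶠ s in 𝓝[≥] t, U s ω = U t ω
  left_limits : ∀ ω t, ∃ u, ∀ᶠ s in 𝓝[<] t, U s ω = u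
  martingale : ∀ f : List (Fin K) → ℝ, (∃ C, ∀ u, |f u| ≤ C) →
    Martingale
      (fun t ω => f (U t ω) -
        ∫ s in (0 : ℝ)..(t : ℝ), queueGenerator n m lam mu f (U s.toNNReal ω)) F P

/-- Load of one class: arrival rate times server need over (number of servers times service rate).
-/
noncomputable def classLoad (n : ℕ) (lam : ℝ) (m : ℕ) (mu : ℝ) : ℝ := lam * m / (n * mu)

/-- `y` solves `y_i' = 1 - min (mu_i * y_i) (1 / ρ_i)` on `[0, ∞)` with `y 0 = y0`. -/
def IsFluidSolution {K : ℕ} (mu ρ y0 : Fin K → ℝ) (y : ℝ → Fin K → ℝ) : Prop :=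
  y 0 = y0 ∧ ∀ i, ∀ t, 0 ≤ t →
    HasDerivWithinAt (fun s => y s i) (1 - min (mu i * y t i) (1 / ρ i)) (Set.Ici 0) t

/-! Started below `1 / (ρ * mu i)`, with `ρ` the total load, the fluid path never reaches the
truncation in the ODE. It therefore solves the linear equation `y' = 1 - mu * y`, stays below `max
(y0 i) (1 / mu i)` and relaxes exponentially to `1 / mu i`. Along it the jobs need a fraction of the
servers bounded away from 1, so in a small tube around it every job is in service and the queue has
the drift of independent infinite-server queues. Let `h` be the squared distance of the scaled
counts from the fluid path. Inside the tube the drift of `h` is `-2 * mu * (x - y) ^ 2` summed over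
classes, plus a noise term of order `1 / lam`. The martingale problem covers only bounded functions
and nothing is known about the drift after blocking, so `h` is replaced by `cutoff δ h`, the square
of the positive part of `δ - h`, which vanishes off the tube. The space-time drift of this function
is everywhere at least `-κ`, with `κ` of order `∑ 1 / lam i` (`cutoffDeriv_add_queueGenerator_ge`).
By a time-dependent Dynkin inequality, `δ ^ 2 - cutoff δ h + κ * (T - t)` is a nonnegative
supermartingale, and the maximal inequality bounds the probability of leaving the tube by a multiple
of its initial mean. That mean tends to 0, because the initial states converge in probability and `m
= o(n)` forces `lam → ∞`. -/

theorem measurable_comp_of_rightConstant {α : Type*} (g : α → ℝ) (X : ℝ≥0 → α)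
    (hX : ∀ t, ∀ᶠ s in 𝓝[≥] t, X s = X t) : Measurable fun v : ℝ => g (X v.toNNReal) := by
  refine measurable_of_tendsto_metrizable
    -- The grid points lie to the right of `v`, where right-constancy applies; each approximant
    -- factors through the discrete `ℤ`, so `g` and `X` need no measurability.
    (f := fun (n : ℕ) (v : ℝ) => g (X (((⌊v * (n + 1)⌋ : ℝ) + 1) / (n + 1)).toNNReal)) ?_ ?_
  · intro n
    exact (measurable_from_top (f := fun z : ℤ => g (X (((z : ℝ) + 1) / (n + 1)).toNNReal))).comp
      (Int.measurable_floor.comp (measurable_id.mul_const _))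
  · rw [tendsto_pi_nhds]
    intro v
    have hpos : ∀ n : ℕ, (0 : ℝ) < n + 1 := fun n => by positivity
    have hge : ∀ n : ℕ, v ≤ ((⌊v * (n + 1)⌋ : ℝ) + 1) / (n + 1) := fun n => by
      rw [le_div_iff₀ (hpos n)]
      exact (Int.lt_floor_add_one _).le
    have hle : ∀ n : ℕ, ((⌊v * (n + 1)⌋ : ℝ) + 1) / (n + 1) ≤ v + 1 / ((n : ℝ) + 1) := fun n => by
      rw [add_div]
      have : (⌊v * (n + 1)⌋ : ℝ) / (n + 1) ≤ v := by
        rw [div_le_iff₀ (hpos n)]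
        exact Int.floor_le _
      linarith
    have hlim : Tendsto (fun n : ℕ => ((⌊v * (n + 1)⌋ : ℝ) + 1) / (n + 1)) atTop (𝓝 v) := by
      refine tendsto_of_tendsto_of_tendsto_of_le_of_le tendsto_const_nhds ?_ hge hle
      simpa using (tendsto_const_nhds (x := v)).add (tendsto_one_div_add_atTop_nhds_zero_nat (𝕜 := ℝ))
    have hlim' : Tendsto (fun n : ℕ => (((⌊v * (n + 1)⌋ : ℝ) + 1) / (n + 1)).toNNReal) atTop
        (𝓝[≥] v.toNNReal) :=
      tendsto_nhdsWithin_iff.2 ⟨(continuous_real_toNNReal.tendsto v).comp hlim,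
        Eventually.of_forall fun n => Real.toNNReal_le_toNNReal (hge n)⟩
    refine tendsto_const_nhds.congr' ?_
    filter_upwards [hlim'.eventually (hX v.toNNReal)] with n hn
    rw [hn]

/-! ### Bounded generator and Dynkin's formula -/

section Generator

variable {K : ℕ} {n : ℕ} {m : Fin K → ℕ} {lam mu : Fin K → ℝ}

theorem length_inService_le (hm : ∀ i, 0 < m i) (c : ℕ) (u : List (Fin K)) :
    (inService m c u).length ≤ c := by
  induction u generalizing c with
  | nil => simp [inService]
  | cons i u ih =>
    rw [inService]
    split_ifs with h
    · have h1 := ih (c - m i)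
      have h2 := hm i
      simp only [List.length_cons]
      omega
    · simp

theorem inService_eq_self (c : ℕ) (u : List (Fin K)) (h : (u.map m).sum ≤ c) :
    inService m c u = u := by
  induction u generalizing c with
  | nil => rfl
  | cons i u ih =>
    simp only [List.map_cons, List.sum_cons] at h
    rw [inService, if_pos (by omega), ih _ (by omega)]

/-- Every job in service holds at least one server, so at most `n` departure terms occur. -/
theorem abs_queueGenerator_le (hm : ∀ i, 0 < m i) (hlam : ∀ i, 0 ≤ lam i) (hmu : ∀ i, 0 ≤ mu i)
    {f : List (Fin K) → ℝ} {B : ℝ} (hf : ∀ u, |f u| ≤ B) (u : List (Fin K)) :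
    |queueGenerator n m lam mu f u| ≤ (∑ i, lam i) * (2 * B) + n * ((∑ i, mu i) * (2 * B)) := by
  have hB : 0 ≤ B := (abs_nonneg _).trans (hf [])
  have hdiff : ∀ a b, |f a - f b| ≤ 2 * B := fun a b =>
    (abs_sub _ _).trans (by linarith [hf a, hf b])
  rw [queueGenerator]
  refine (abs_add_le _ _).trans (add_le_add ?_ ?_)
  · refine (Finset.abs_sum_le_sum_abs _ _).trans ?_
    rw [Finset.sum_mul]
    refine Finset.sum_le_sum fun i _ => ?_
    rw [abs_mul, abs_of_nonneg (hlam i)]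
    exact mul_le_mul_of_nonneg_left (hdiff _ _) (hlam i)
  · refine (Finset.abs_sum_le_sum_abs _ _).trans ?_
    have hS : 0 ≤ (∑ i, mu i) * (2 * B) :=
      mul_nonneg (Finset.sum_nonneg fun i _ => hmu i) (by linarith)
    refine (Finset.sum_le_card_nsmul _ _ ((∑ i, mu i) * (2 * B)) fun j _ => ?_).trans ?_
    · rw [abs_mul, abs_of_nonneg (hmu _)]
      exact mul_le_mul (Finset.single_le_sum (f := mu) (fun i _ => hmu i) (Finset.mem_univ _))
        (hdiff _ _) (abs_nonneg _) (Finset.sum_nonneg fun i _ => hmu i)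
    · rw [nsmul_eq_mul]
      refine mul_le_mul_of_nonneg_right ?_ hS
      simpa using length_inService_le hm n u

variable {Ω : Type*} {mΩ : MeasurableSpace Ω} {P : Measure Ω}
  {F : Filtration ℝ≥0 mΩ} {U : ℝ≥0 → Ω → List (Fin K)}

theorem IsMultiserverJobProcess.measurable_comp (hU : IsMultiserverJobProcess n m lam mu P F U)
    (f : List (Fin K) → ℝ) (t : ℝ≥0) : Measurable fun ω => f (U t ω) := by
  let _ : MeasurableSpace (List (Fin K)) := ⊤
  have h : Measurable (U t) := measurable_to_countable' fun u => F.le t _ (hU.adapted t u)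
  exact (measurable_from_top (f := f)).comp h

theorem IsMultiserverJobProcess.measurableSet_comp (hU : IsMultiserverJobProcess n m lam mu P F U)
    (t : ℝ≥0) (S : Set (List (Fin K))) : MeasurableSet[F t] {ω | U t ω ∈ S} := by
  let _ : MeasurableSpace (List (Fin K)) := ⊤
  have h : Measurable[F t] (U t) :=
    @measurable_to_countable' _ _ _ _ (F t) _ fun u => hU.adapted t u
  exact h (show MeasurableSet S from trivial)

theorem IsMultiserverJobProcess.intervalIntegrable_generator
    (hU : IsMultiserverJobProcess n m lam mu P F U) (hm : ∀ i, 0 < m i) (hlam : ∀ i, 0 ≤ lam i)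
    (hmu : ∀ i, 0 ≤ mu i) {f : List (Fin K) → ℝ} {B : ℝ} (hf : ∀ u, |f u| ≤ B) (a b : ℝ) (ω : Ω) :
    IntervalIntegrable (fun v : ℝ => queueGenerator n m lam mu f (U v.toNNReal ω)) volume a b := by
  refine (intervalIntegrable_const (c := (∑ i, lam i) * (2 * B) +
    n * ((∑ i, mu i) * (2 * B)))).mono_fun ?_ (Eventually.of_forall fun v => ?_)
  · exact (measurable_comp_of_rightConstant (queueGenerator n m lam mu f) (fun s => U s ω)
      (hU.right_continuous ω)).aestronglyMeasurable
  · exact (abs_queueGenerator_le hm hlam hmu hf _).trans (le_abs_self _)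

variable [IsProbabilityMeasure P]

theorem IsMultiserverJobProcess.integrable_comp (hU : IsMultiserverJobProcess n m lam mu P F U)
    {f : List (Fin K) → ℝ} {B : ℝ} (hf : ∀ u, |f u| ≤ B) (t : ℝ≥0) :
    Integrable (fun ω => f (U t ω)) P :=
  (integrable_const B).mono' (hU.measurable_comp f t).aestronglyMeasurable
    (Eventually.of_forall fun _ => hf _)

/-- The time integral from 0 is `f (U t)` minus the martingale, both integrable; joint measurability
in time and `ω` is never needed. -/
theorem IsMultiserverJobProcess.integrable_integral_generator
    (hU : IsMultiserverJobProcess n m lam mu P F U) (hm : ∀ i, 0 < m i) (hlam : ∀ i, 0 ≤ lam i)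
    (hmu : ∀ i, 0 ≤ mu i) {f : List (Fin K) → ℝ} {B : ℝ} (hf : ∀ u, |f u| ≤ B) {a b : ℝ}
    (ha : 0 ≤ a) (hb : 0 ≤ b) :
    Integrable (fun ω => ∫ v in a..b, queueGenerator n m lam mu f (U v.toNNReal ω)) P := by
  have key : ∀ t : ℝ, 0 ≤ t →
      Integrable (fun ω => ∫ v in (0 : ℝ)..t, queueGenerator n m lam mu f (U v.toNNReal ω)) P := by
    intro t ht
    have h := (hU.integrable_comp hf t.toNNReal).sub
      ((hU.martingale f ⟨B, hf⟩).integrable t.toNNReal)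
    refine h.congr (Eventually.of_forall fun ω => ?_)
    simp [Real.coe_toNNReal _ ht]
  refine ((key b hb).sub (key a ha)).congr (Eventually.of_forall fun ω => ?_)
  exact intervalIntegral.integral_interval_sub_left
    (hU.intervalIntegrable_generator hm hlam hmu hf _ _ ω)
    (hU.intervalIntegrable_generator hm hlam hmu hf _ _ ω)

theorem IsMultiserverJobProcess.setIntegral_sub
    (hU : IsMultiserverJobProcess n m lam mu P F U) (hm : ∀ i, 0 < m i) (hlam : ∀ i, 0 ≤ lam i)
    (hmu : ∀ i, 0 ≤ mu i) {f : List (Fin K) → ℝ} {B : ℝ} (hf : ∀ u, |f u| ≤ B) {a b : ℝ}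
    (ha : 0 ≤ a) (hab : a ≤ b) {A : Set Ω} (hA : MeasurableSet[F a.toNNReal] A) :
    ∫ ω in A, (f (U b.toNNReal ω) - f (U a.toNNReal ω)) ∂P =
      ∫ ω in A, (∫ v in a..b, queueGenerator n m lam mu f (U v.toNNReal ω)) ∂P := by
  have hM := hU.martingale f ⟨B, hf⟩
  have h := hM.setIntegral_eq (Real.toNNReal_le_toNNReal hab) hA
  have h1 := (hM.integrable a.toNNReal).integrableOn (s := A)
  have h2 := (hM.integrable b.toNNReal).integrableOn (s := A)
  have h3 := (hU.integrable_integral_generator hm hlam hmu hf ha (ha.trans hab)).integrableOn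
    (s := A)
  have h4 : ∀ ω, f (U b.toNNReal ω) - f (U a.toNNReal ω) =
      (∫ v in a..b, queueGenerator n m lam mu f (U v.toNNReal ω)) +
      ((f (U b.toNNReal ω) - ∫ v in (0 : ℝ)..(b.toNNReal : ℝ),
          queueGenerator n m lam mu f (U v.toNNReal ω)) -
        (f (U a.toNNReal ω) - ∫ v in (0 : ℝ)..(a.toNNReal : ℝ),
          queueGenerator n m lam mu f (U v.toNNReal ω))) := by
    intro ω
    rw [Real.coe_toNNReal _ ha, Real.coe_toNNReal _ (ha.trans hab),
      ← intervalIntegral.integral_interval_sub_left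
        (hU.intervalIntegrable_generator hm hlam hmu hf 0 b ω)
        (hU.intervalIntegrable_generator hm hlam hmu hf 0 a ω)]
    ring
  rw [integral_congr_ae (Eventually.of_forall h4)]
  refine (integral_add h3 (h2.sub h1)).trans ?_
  rw [integral_sub' h2 h1, h, sub_self, add_zero]

/-- Time-dependent Dynkin inequality. -/
theorem IsMultiserverJobProcess.setIntegral_le_of_generator_ge
    (hU : IsMultiserverJobProcess n m lam mu P F U) (hm : ∀ i, 0 < m i) (hlam : ∀ i, 0 ≤ lam i)
    (hmu : ∀ i, 0 ≤ mu i) {φ φ' : ℝ → List (Fin K) → ℝ} {B C κ : ℝ} (hB : ∀ t u, |φ t u| ≤ B)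
    (hd : ∀ t u, HasDerivAt (fun s => φ s u) (φ' t u) t) (hC : ∀ t, 0 ≤ t → ∀ u, |φ' t u| ≤ C)
    (hκ : ∀ t, 0 ≤ t → ∀ u, -κ ≤ φ' t u + queueGenerator n m lam mu (φ t) u)
    {s t : ℝ≥0} (hst : s ≤ t) {A : Set Ω} (hA : MeasurableSet[F s] A) :
    ∫ ω in A, φ s (U s ω) ∂P - κ * (t - s) * P.real A ≤ ∫ ω in A, φ t (U t ω) ∂P := by
  set D : ℝ := (∑ i, lam i) * (2 * B) + n * ((∑ i, mu i) * (2 * B)) with hD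
  have hL : ∀ r u, |queueGenerator n m lam mu (φ r) u| ≤ D := fun r u =>
    abs_queueGenerator_le hm hlam hmu (hB r) u
  have hlipφ : ∀ t, 0 ≤ t → ∀ t', 0 ≤ t' → ∀ u, |φ t' u - φ t u| ≤ C * |t' - t| :=
    fun t ht t' ht' u => (convex_Ici (0 : ℝ)).norm_image_sub_le_of_norm_hasDerivWithin_le
      (fun r _ => (hd r u).hasDerivWithinAt) (fun r hr => hC r hr u) ht ht'
  set G : ℝ → ℝ := fun r => ∫ ω in A, φ r (U r.toNNReal ω) ∂P with hG
  have hint : ∀ r r' : ℝ, IntegrableOn (fun ω => φ r (U r'.toNNReal ω)) A P := fun r r' =>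
    (hU.integrable_comp (hB r) _).integrableOn
  -- The increment over `[r, r']` is split into the change of `φ` in time at the final state and the
  -- motion of the state under the frozen function `φ r`.
  set I : ℝ → ℝ → Ω → ℝ := fun r r' ω => (φ r' (U r'.toNNReal ω) - φ r (U r'.toNNReal ω)) +
    ∫ v in r..r', queueGenerator n m lam mu (φ r) (U v.toNNReal ω) with hI
  have hIint : ∀ r r' : ℝ, 0 ≤ r → 0 ≤ r' → IntegrableOn (I r r') A P := fun r r' hr hr' =>
    ((hint r' r').sub (hint r r')).add
      (hU.integrable_integral_generator hm hlam hmu (hB r) hr hr').integrableOn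
  have hinc : ∀ r r' : ℝ, s ≤ r → r ≤ r' → G r' - G r = ∫ ω in A, I r r' ω ∂P := by
    intro r r' hr hrr'
    have hr0 : 0 ≤ r := s.2.trans hr
    have hAr : MeasurableSet[F r.toNNReal] A := F.mono (NNReal.le_toNNReal_of_coe_le hr) _ hA
    have h := hU.setIntegral_sub hm hlam hmu (hB r) hr0 hrr' hAr
    simp only [hI, hG]
    refine Eq.trans ?_ (integral_add ((hint r' r').sub (hint r r'))
      (hU.integrable_integral_generator hm hlam hmu (hB r) hr0 (hr0.trans hrr')).integrableOn).symm
    rw [← h, integral_sub' (hint r' r') (hint r r'), integral_sub (hint r r') (hint r r)]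
    ring
  have hIle : ∀ r r' : ℝ, 0 ≤ r → r ≤ r' → ∀ ω, |I r r' ω| ≤ (C + D) * (r' - r) := by
    intro r r' hr hrr' ω
    have h1 := hlipφ r hr r' (hr.trans hrr') (U r'.toNNReal ω)
    have h2 := intervalIntegral.norm_integral_le_of_norm_le_const (a := r) (b := r') (C := D)
      (f := fun v => queueGenerator n m lam mu (φ r) (U v.toNNReal ω)) (fun v _ => hL r _)
    rw [Real.norm_eq_abs] at h2
    rw [abs_of_nonneg (sub_nonneg.2 hrr')] at h1 h2
    refine (abs_add_le _ _).trans ?_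
    linarith
  have hcont : ContinuousOn G (Set.Icc s t) := by
    have hlip : ∀ r r' : ℝ, s ≤ r → r ≤ r' → |G r' - G r| ≤ |(C + D) * P.real A| * (r' - r) := by
      intro r r' hr hrr'
      rw [hinc r r' hr hrr']
      have := norm_setIntegral_le_of_norm_le_const (measure_lt_top P A)
        (f := I r r') (fun ω _ => hIle r r' (s.2.trans hr) hrr' ω)
      rw [Real.norm_eq_abs] at this
      refine this.trans ?_
      have h0 := mul_le_mul_of_nonneg_right (le_abs_self ((C + D) * P.real A)) (sub_nonneg.2 hrr')
      linarith
    refine LipschitzOnWith.continuousOn (K := |(C + D) * P.real A|.toNNReal)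
      (LipschitzOnWith.of_dist_le_mul fun r hr r' hr' => ?_)
    rw [Real.coe_toNNReal _ (abs_nonneg _), Real.dist_eq, Real.dist_eq]
    rcases le_total r r' with h | h
    · rw [abs_sub_comm, abs_sub_comm r, abs_of_nonneg (sub_nonneg.2 h)]
      exact hlip r r' hr.1 h
    · rw [abs_of_nonneg (sub_nonneg.2 h)]
      exact hlip r' r hr'.1 h
  have hderiv : ∀ r ∈ Set.Ico (s : ℝ) t, HasDerivWithinAt G (∫ ω in A, (φ' r (U r.toNNReal ω) +
      queueGenerator n m lam mu (φ r) (U r.toNNReal ω)) ∂P) (Set.Ici r) r := by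
    intro r hr
    have hr0 : 0 ≤ r := s.2.trans hr.1
    rw [← hasDerivWithinAt_Ioi_iff_Ici, hasDerivWithinAt_iff_tendsto_slope' (by simp)]
    have hslope : ∀ᶠ r' in 𝓝[>] r, ∫ ω in A, (r' - r)⁻¹ * I r r' ω ∂P = slope G r r' := by
      filter_upwards [self_mem_nhdsWithin] with r' hr'
      rw [slope_def_field, hinc r r' hr.1 (le_of_lt hr'), integral_const_mul]
      field_simp
    refine Tendsto.congr' hslope ?_
    refine tendsto_integral_filter_of_dominated_convergence (fun _ => C + D) ?_ ?_
      (integrable_const _) ?_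
    · filter_upwards [self_mem_nhdsWithin] with r' hr'
      exact (hIint r r' hr0 (hr0.trans (le_of_lt hr'))).aestronglyMeasurable.const_mul _
    · filter_upwards [self_mem_nhdsWithin] with r' hr'
      refine Eventually.of_forall fun ω => ?_
      have h0 : 0 < r' - r := sub_pos.2 hr'
      rw [Real.norm_eq_abs, abs_mul, abs_of_pos (inv_pos.2 h0), inv_mul_le_iff₀ h0, mul_comm]
      exact hIle r r' hr0 (le_of_lt hr') ω
    · refine Eventually.of_forall fun ω => ?_
      have hd' := (hasDerivWithinAt_iff_tendsto_slope' (by simp)).1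
        (hasDerivWithinAt_Ioi_iff_Ici.2 (hd r (U r.toNNReal ω)).hasDerivWithinAt)
      refine (hd'.add_const (queueGenerator n m lam mu (φ r) (U r.toNNReal ω))).congr' ?_
      -- The state space is discrete, so the path is constant just after `r` and the generator
      -- integral there is exactly linear in `r' - r`.
      have hconst : ∀ᶠ v in 𝓝[≥] r, U v.toNNReal ω = U r.toNNReal ω := by
        have : Tendsto Real.toNNReal (𝓝[≥] r) (𝓝[≥] r.toNNReal) :=
          tendsto_nhdsWithin_iff.2 ⟨(continuous_real_toNNReal.tendsto r).mono_left inf_le_left,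
            eventually_nhdsWithin_of_forall fun v hv => Real.toNNReal_le_toNNReal hv⟩
        exact this.eventually (hU.right_continuous ω _)
      obtain ⟨b, hb, hb'⟩ := (mem_nhdsGE_iff_exists_Ico_subset).1 hconst
      filter_upwards [Ioo_mem_nhdsGT hb] with r' hr'
      have h0 : 0 < r' - r := sub_pos.2 hr'.1
      have e1 : U r'.toNNReal ω = U r.toNNReal ω := hb' ⟨hr'.1.le, hr'.2⟩
      have e2 : ∫ v in r..r', queueGenerator n m lam mu (φ r) (U v.toNNReal ω) =
          (r' - r) * queueGenerator n m lam mu (φ r) (U r.toNNReal ω) := by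
        rw [intervalIntegral.integral_congr
          (g := fun _ => queueGenerator n m lam mu (φ r) (U r.toNNReal ω)),
          intervalIntegral.integral_const, smul_eq_mul]
        intro v hv
        rw [Set.uIcc_of_le hr'.1.le] at hv
        have : U v.toNNReal ω = U r.toNNReal ω := hb' ⟨hv.1, hv.2.trans_lt hr'.2⟩
        simp only [this]
      simp only [hI]
      rw [e1, e2, slope_def_field]
      field_simp
  -- `G` is continuous with right derivative at least `-κ * P.real A`; comparing `-G` with a
  -- straight line integrates this bound.
  have hmain := image_le_of_deriv_right_le_deriv_boundary (a := (s : ℝ)) (b := t)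
    (f := fun r => -G r) (B := fun r => -G s + κ * P.real A * (r - s))
    (B' := fun _ => κ * P.real A)
    hcont.neg (fun r hr => (hderiv r hr).neg) (by simp) (by fun_prop)
    (fun r _ => by
      have := ((hasDerivAt_id r).sub_const (s : ℝ)).const_mul (κ * P.real A) |>.const_add (-G s)
      simpa using this.hasDerivWithinAt)
    (fun r hr => by
      have hr0 : 0 ≤ r := s.2.trans hr.1
      have h1 : ∫ _ in A, (-κ) ∂P ≤ ∫ ω in A, (φ' r (U r.toNNReal ω) +
          queueGenerator n m lam mu (φ r) (U r.toNNReal ω)) ∂P := by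
        refine integral_mono (integrable_const _) ?_ fun ω => hκ r hr0 _
        refine Integrable.add ?_ ?_
        · exact (hU.integrable_comp (hC r hr0) _).integrableOn
        · exact (hU.integrable_comp (hL r) _).integrableOn
      simp only [integral_const, measureReal_restrict_apply_univ, smul_eq_mul] at h1
      linarith)
    (Set.right_mem_Icc.2 (NNReal.coe_le_coe.2 hst))
  simp only [hG, Real.toNNReal_coe] at hmain
  linarith

end Generator

/-! ### Maximal inequality and the truncation function -/

/-- Maximal inequality for nonnegative supermartingales, over a finite set of times. -/
theorem mul_measureReal_exists_le_setIntegral {Ω : Type*} {mΩ : MeasurableSpace Ω}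
    {P : Measure Ω} [IsFiniteMeasure P] {F : Filtration ℝ≥0 mΩ} {Z : ℝ≥0 → Ω → ℝ} {T : ℝ≥0}
    (hZ0 : ∀ t ≤ T, ∀ ω, 0 ≤ Z t ω) (hZm : ∀ t ε, MeasurableSet[F t] {ω | ε ≤ Z t ω})
    (hZi : ∀ t, Integrable (Z t) P)
    (hZ : ∀ s t, s ≤ t → t ≤ T → ∀ A, MeasurableSet[F s] A →
      ∫ ω in A, Z t ω ∂P ≤ ∫ ω in A, Z s ω ∂P) (ε : ℝ) (S : Finset ℝ≥0) :
    ∀ s ≤ T, (∀ q ∈ S, s ≤ q ∧ q ≤ T) → ∀ A, MeasurableSet[F s] A →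
      ε * P.real (A ∩ {ω | ∃ q ∈ S, ε ≤ Z q ω}) ≤ ∫ ω in A, Z s ω ∂P := by
  induction S using Finset.induction_on_min with
  | empty =>
    intro s hs _ A _
    simpa using integral_nonneg fun ω => hZ0 s hs ω
  -- Split `A` at the earliest time `a`: where `Z a` already reaches `ε` the bound is immediate, and
  -- the rest is passed to the later times.
  | insert a S ha ih =>
    intro s hs hS A hA
    obtain ⟨hsa, haT⟩ := hS a (Finset.mem_insert_self _ _)
    have hAa : MeasurableSet[F a] A := F.mono hsa _ hA
    have hA1 : MeasurableSet[F a] (A ∩ {ω | ε ≤ Z a ω}) := hAa.inter (hZm a ε)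
    have hA2 : MeasurableSet[F a] (A \ {ω | ε ≤ Z a ω}) := hAa.diff (hZm a ε)
    have h2 := ih a haT (fun q hq => ⟨(ha q hq).le, (hS q (Finset.mem_insert_of_mem hq)).2⟩) _ hA2
    have h1 : ε * P.real (A ∩ {ω | ε ≤ Z a ω}) ≤ ∫ ω in A ∩ {ω | ε ≤ Z a ω}, Z a ω ∂P := by
      have := setIntegral_mono_on (integrableOn_const (C := ε) (measure_ne_top P _))
        (hZi a).integrableOn (F.le a _ hA1) (fun ω hω => hω.2)
      simpa [mul_comm] using this
    have h3 := integral_inter_add_sdiff (F.le a _ (hZm a ε)) (hZi a).integrableOn (s := A)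
    have h4 := hZ s a hsa haT A hA
    have hsub : A ∩ {ω | ∃ q ∈ insert a S, ε ≤ Z q ω} ⊆
        (A ∩ {ω | ε ≤ Z a ω}) ∪ ((A \ {ω | ε ≤ Z a ω}) ∩ {ω | ∃ q ∈ S, ε ≤ Z q ω}) := by
      rintro ω ⟨hωA, q, hq, hqω⟩
      by_cases h : ε ≤ Z a ω
      · exact Or.inl ⟨hωA, h⟩
      · rcases Finset.mem_insert.1 hq with rfl | hq
        · exact absurd hqω h
        · exact Or.inr ⟨⟨hωA, h⟩, q, hq, hqω⟩
    rcases le_total ε 0 with hε | hε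
    · have : 0 ≤ ∫ ω in A, Z s ω ∂P := integral_nonneg fun ω => hZ0 s hs ω
      exact (mul_nonpos_of_nonpos_of_nonneg hε measureReal_nonneg).trans this
    · have h5 := mul_le_mul_of_nonneg_left
        ((measureReal_mono hsub).trans (measureReal_union_le (μ := P) _ _)) hε
      linarith

/-- Smooth decreasing cutoff, vanishing on `[δ, ∞)`. -/
noncomputable def cutoff (δ x : ℝ) : ℝ := (max 0 (δ - x)) ^ 2

theorem cutoff_nonneg (δ x : ℝ) : 0 ≤ cutoff δ x := sq_nonneg _

theorem cutoff_le {δ x : ℝ} (hδ : 0 ≤ δ) (hx : 0 ≤ x) : cutoff δ x ≤ δ ^ 2 :=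
  pow_le_pow_left₀ (le_max_left _ _) (max_le hδ (by linarith)) 2

/-- A convex function lies above its tangent at `a`. -/
theorem cutoff_sub_ge (δ a b : ℝ) : -(2 * max 0 (δ - a)) * (b - a) ≤ cutoff δ b - cutoff δ a := by
  unfold cutoff
  rcases max_cases 0 (δ - a) with ⟨h, h'⟩ | ⟨h, h'⟩ <;>
  rcases max_cases 0 (δ - b) with ⟨k, k'⟩ | ⟨k, k'⟩ <;> rw [h, k] <;> nlinarith [sq_nonneg (a - b)]

theorem hasDerivAt_sq_max_zero (x : ℝ) :
    HasDerivAt (fun x : ℝ => (max 0 x) ^ 2) (2 * max 0 x) x := by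
  rcases lt_trichotomy x 0 with h | rfl | h
  · rw [max_eq_left h.le, mul_zero]
    refine (hasDerivAt_const x (0 : ℝ)).congr_of_eventuallyEq ?_
    filter_upwards [Iio_mem_nhds h] with z hz
    simp [max_eq_left (le_of_lt (Set.mem_Iio.1 hz))]
  · rw [hasDerivAt_iff_isLittleO]
    simp only [sub_zero, max_self, mul_zero, smul_zero, ne_eq, OfNat.ofNat_ne_zero,
      not_false_eq_true, zero_pow]
    refine (IsBigO.of_bound 1 (Eventually.of_forall fun z => ?_)).trans_isLittleO
      (isLittleO_pow_id (𝕜 := ℝ) (n := 2) one_lt_two)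
    rw [one_mul, norm_pow, norm_pow]
    refine pow_le_pow_left₀ (norm_nonneg _) ?_ 2
    rw [Real.norm_eq_abs, Real.norm_eq_abs, abs_of_nonneg (le_max_left _ _)]
    exact max_le (abs_nonneg _) (le_abs_self _)
  · rw [max_eq_right h.le]
    have : HasDerivAt (fun x : ℝ => x ^ 2) (2 * x) x := by simpa using hasDerivAt_pow 2 x
    refine this.congr_of_eventuallyEq ?_
    filter_upwards [Ioi_mem_nhds h] with z hz
    simp [max_eq_right (le_of_lt (Set.mem_Ioi.1 hz))]

/-! ### Drift of the truncated squared distance to the fluid path -/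

section Drift

variable {K : ℕ} {n : ℕ} {m : Fin K → ℕ} {lam mu : Fin K → ℝ}

theorem sum_map_eq_sum_count (g : Fin K → ℝ) (u : List (Fin K)) :
    (u.map g).sum = ∑ i, (u.count i : ℝ) * g i := by
  induction u with
  | nil => simp
  | cons a u ih =>
    simp only [List.map_cons, List.sum_cons, ih, List.count_cons, Nat.cast_add, add_mul,
      Finset.sum_add_distrib]
    simp [add_comm]

/-- Squared distance of the scaled job counts from the point `y`. -/
noncomputable def sqDistScaled (lam y : Fin K → ℝ) (u : List (Fin K)) : ℝ :=
  ∑ i, ((u.count i : ℝ) / lam i - y i) ^ 2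

theorem sqDistScaled_nonneg (y : Fin K → ℝ) (u : List (Fin K)) : 0 ≤ sqDistScaled lam y u :=
  Finset.sum_nonneg fun _ _ => sq_nonneg _

theorem sqDistScaled_append_sub (y : Fin K → ℝ) (u : List (Fin K)) (c : Fin K) :
    sqDistScaled lam y (u ++ [c]) - sqDistScaled lam y u =
      2 * ((u.count c : ℝ) / lam c - y c) / lam c + 1 / lam c ^ 2 := by
  rw [sqDistScaled, sqDistScaled, ← Finset.sum_sub_distrib, Finset.sum_eq_single c]
  · simp only [List.count_append, List.count_singleton_self, Nat.cast_add, Nat.cast_one]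
    ring
  · intro b _ hb
    simp [List.count_append, hb.symm]
  · simp

theorem sqDistScaled_eraseIdx_sub (y : Fin K → ℝ) (u : List (Fin K)) (j : Fin u.length) :
    sqDistScaled lam y (u.eraseIdx j) - sqDistScaled lam y u =
      -(2 * ((u.count (u.get j) : ℝ) / lam (u.get j) - y (u.get j)) / lam (u.get j)) +
        1 / lam (u.get j) ^ 2 := by
  have hcount : ∀ i, (u.count i : ℝ) =
      ((u.eraseIdx j).count i : ℝ) + if u.get j = i then 1 else 0 := by
    intro i
    have := (List.getElem_cons_eraseIdx_perm j.2).count_eq i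
    rw [List.count_cons] at this
    rw [← this]
    simp
  rw [sqDistScaled, sqDistScaled, ← Finset.sum_sub_distrib, Finset.sum_eq_single (u.get j)]
  · rw [hcount (u.get j), if_pos rfl]
    ring
  · intro b _ hb
    rw [hcount b, if_neg hb.symm, add_zero, sub_self]
  · simp

/-- All jump rates are nonnegative, so an inequality between increments survives the generator. With
`cutoff_sub_ge` it serves as a one-sided chain rule. -/
theorem queueGenerator_ge_mul (hlam : ∀ i, 0 ≤ lam i) (hmu : ∀ i, 0 ≤ mu i)
    {f g : List (Fin K) → ℝ} {p : ℝ} {u : List (Fin K)}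
    (h : ∀ v, p * (g v - g u) ≤ f v - f u) :
    p * queueGenerator n m lam mu g u ≤ queueGenerator n m lam mu f u := by
  rw [queueGenerator, queueGenerator, mul_add, Finset.mul_sum, Finset.mul_sum]
  refine add_le_add (Finset.sum_le_sum fun i _ => ?_) (Finset.sum_le_sum fun j _ => ?_)
  · rw [mul_left_comm]
    exact mul_le_mul_of_nonneg_left (h _) (hlam i)
  · rw [mul_left_comm]
    exact mul_le_mul_of_nonneg_left (h _) (hmu _)

theorem queueGenerator_sqDistScaled (hlam : ∀ i, 0 < lam i) (y : Fin K → ℝ) (u : List (Fin K))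
    (hu : ∑ i, (u.count i : ℝ) * m i ≤ n) :
    queueGenerator n m lam mu (sqDistScaled lam y) u =
      ∑ i, (2 * ((u.count i : ℝ) / lam i - y i) * (1 - mu i * ((u.count i : ℝ) / lam i)) +
        (1 + mu i * ((u.count i : ℝ) / lam i)) / lam i) := by
  have hs : inService m n u = u := by
    refine inService_eq_self n u ?_
    rw [← sum_map_eq_sum_count (fun i => (m i : ℝ))] at hu
    have : ((u.map m).sum : ℝ) = (u.map fun i => (m i : ℝ)).sum := by
      rw [Nat.cast_list_sum, List.map_map]
      rfl
    exact_mod_cast this.trans_le hu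
  -- Abstracting the list of served jobs lets it be rewritten to `u` although the index type of the
  -- sum depends on it.
  let R : List (Fin K) → ℝ := fun l => ∑ j : Fin l.length,
    mu (l.get j) * (sqDistScaled lam y (u.eraseIdx j) - sqDistScaled lam y u)
  have hR : R (inService m n u) = ∑ i, (u.count i : ℝ) *
      (mu i * (-(2 * ((u.count i : ℝ) / lam i - y i) / lam i) + 1 / lam i ^ 2)) := by
    rw [hs, ← sum_map_eq_sum_count, ← Fin.sum_univ_fun_getElem]
    refine Finset.sum_congr rfl fun j _ => ?_
    rw [sqDistScaled_eraseIdx_sub]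
    rfl
  change _ + R (inService m n u) = _
  rw [hR, ← Finset.sum_add_distrib]
  refine Finset.sum_congr rfl fun i _ => ?_
  rw [sqDistScaled_append_sub]
  have := (hlam i).ne'
  field_simp
  ring

/-- The solution of `y_i' = 1 - mu_i * y_i` started at `y0`. -/
noncomputable def fluidPath (mu y0 : Fin K → ℝ) (t : ℝ) (i : Fin K) : ℝ :=
  1 / mu i + (y0 i - 1 / mu i) * Real.exp (-mu i * t)

theorem fluidPath_zero (y0 : Fin K → ℝ) : fluidPath mu y0 0 = y0 := by
  ext i
  simp [fluidPath]

theorem hasDerivAt_fluidPath (hmu : ∀ i, 0 < mu i) (y0 : Fin K → ℝ) (t : ℝ) (i : Fin K) :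
    HasDerivAt (fun s => fluidPath mu y0 s i) (1 - mu i * fluidPath mu y0 t i) t := by
  have h := ((((hasDerivAt_id t).const_mul (-mu i)).exp).const_mul (y0 i - 1 / mu i)).const_add
    (1 / mu i)
  refine h.congr_deriv ?_
  have := (hmu i).ne'
  simp only [id, fluidPath]
  field_simp
  ring

theorem fluidPath_mem (hmu : ∀ i, 0 < mu i) {y0 : Fin K → ℝ} (hy0 : ∀ i, 0 ≤ y0 i) {t : ℝ}
    (ht : 0 ≤ t) (i : Fin K) :
    0 ≤ fluidPath mu y0 t i ∧ fluidPath mu y0 t i ≤ max (y0 i) (1 / mu i) := by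
  have he0 := Real.exp_pos (-mu i * t)
  have he1 : Real.exp (-mu i * t) ≤ 1 := Real.exp_le_one_iff.2 (by nlinarith [hmu i])
  have hc : fluidPath mu y0 t i =
      (1 - Real.exp (-mu i * t)) * (1 / mu i) + Real.exp (-mu i * t) * y0 i := by
    rw [fluidPath]; ring
  have hm := one_div_pos.2 (hmu i)
  rw [hc]
  constructor
  · exact add_nonneg (mul_nonneg (by linarith) hm.le) (mul_nonneg he0.le (hy0 i))
  · have h1 := mul_le_mul_of_nonneg_left (le_max_right (y0 i) (1 / mu i))
      (sub_nonneg.2 he1)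
    have h2 := mul_le_mul_of_nonneg_left (le_max_left (y0 i) (1 / mu i)) he0.le
    linarith

theorem tendsto_fluidPath (hmu : ∀ i, 0 < mu i) (y0 : Fin K → ℝ) :
    Tendsto (fluidPath mu y0) atTop (𝓝 fun i => 1 / mu i) := by
  rw [tendsto_pi_nhds]
  intro i
  have h : Tendsto (fun t : ℝ => Real.exp (-mu i * t)) atTop (𝓝 0) :=
    Real.tendsto_exp_atBot.comp (tendsto_id.const_mul_atTop_of_neg (neg_neg_of_pos (hmu i)))
  simpa [fluidPath] using (h.const_mul (y0 i - 1 / mu i)).const_add (1 / mu i)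

/-- Time derivative of `cutoff δ (sqDistScaled lam (fluidPath mu y0 t) u)`. -/
noncomputable def cutoffDeriv (lam mu y0 : Fin K → ℝ) (δ t : ℝ) (u : List (Fin K)) : ℝ :=
  -(2 * max 0 (δ - sqDistScaled lam (fluidPath mu y0 t) u)) *
    ∑ i, -(2 * ((u.count i : ℝ) / lam i - fluidPath mu y0 t i) *
      (1 - mu i * fluidPath mu y0 t i))

theorem hasDerivAt_cutoff (hmu : ∀ i, 0 < mu i) (y0 : Fin K → ℝ) (δ t : ℝ) (u : List (Fin K)) :
    HasDerivAt (fun s => cutoff δ (sqDistScaled lam (fluidPath mu y0 s) u))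
      (cutoffDeriv lam mu y0 δ t u) t := by
  have h1 : HasDerivAt (fun s => sqDistScaled lam (fluidPath mu y0 s) u)
      (∑ i, -(2 * ((u.count i : ℝ) / lam i - fluidPath mu y0 t i) *
        (1 - mu i * fluidPath mu y0 t i))) t := by
    unfold sqDistScaled
    refine HasDerivAt.fun_sum fun i _ => ?_
    refine (((hasDerivAt_fluidPath hmu y0 t i).const_sub ((u.count i : ℝ) / lam i)).pow
      2).congr_deriv ?_
    ring
  refine ((hasDerivAt_sq_max_zero _).comp t (h1.const_sub δ)).congr_deriv ?_
  rw [cutoffDeriv]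
  ring

theorem abs_sub_lt_of_sqDistScaled_lt {y : Fin K → ℝ} {u : List (Fin K)} {η : ℝ} (hη : 0 ≤ η)
    (h : sqDistScaled lam y u < η ^ 2) (i : Fin K) : |(u.count i : ℝ) / lam i - y i| < η := by
  have h1 : ((u.count i : ℝ) / lam i - y i) ^ 2 ≤ sqDistScaled lam y u :=
    Finset.single_le_sum (f := fun i => ((u.count i : ℝ) / lam i - y i) ^ 2)
      (fun _ _ => sq_nonneg _) (Finset.mem_univ i)
  exact abs_lt_of_sq_lt_sq (h1.trans_lt h) hη

/-- The prefactor vanishes outside the tube, and inside it each scaled count is within `η` of a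
bounded path. -/
theorem abs_cutoffDeriv_le (hmu : ∀ i, 0 < mu i) {y0 : Fin K → ℝ} (hy0 : ∀ i, 0 ≤ y0 i) {η t : ℝ}
    (hη : 0 ≤ η) (ht : 0 ≤ t) (u : List (Fin K)) :
    |cutoffDeriv lam mu y0 (η ^ 2) t u| ≤
      2 * η ^ 2 * ∑ i, 2 * η * (1 + mu i * max (y0 i) (1 / mu i)) := by
  have hY : ∀ i, 0 ≤ 1 + mu i * max (y0 i) (1 / mu i) := fun i =>
    add_nonneg zero_le_one (mul_nonneg (hmu i).le ((hy0 i).trans (le_max_left _ _)))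
  have hsum : 0 ≤ ∑ i, 2 * η * (1 + mu i * max (y0 i) (1 / mu i)) :=
    Finset.sum_nonneg fun i _ => mul_nonneg (by linarith) (hY i)
  rw [cutoffDeriv]
  set h := sqDistScaled lam (fluidPath mu y0 t) u with hh
  have h0 : 0 ≤ h := sqDistScaled_nonneg _ _
  rcases le_or_gt (η ^ 2) h with hle | hlt
  · rw [max_eq_left (by linarith)]
    simpa using mul_nonneg (by positivity) hsum
  · rw [max_eq_right (by linarith), abs_mul]
    refine mul_le_mul ?_ ?_ (abs_nonneg _) (by positivity)
    · rw [abs_neg, abs_of_nonneg (by linarith)]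
      linarith
    · refine (Finset.abs_sum_le_sum_abs _ _).trans (Finset.sum_le_sum fun i _ => ?_)
      have h1 := abs_sub_lt_of_sqDistScaled_lt hη hlt i
      obtain ⟨h2, h3⟩ := fluidPath_mem hmu hy0 ht i
      have h4 := mul_le_mul_of_nonneg_left h3 (hmu i).le
      have h5 := mul_nonneg (hmu i).le h2
      rw [abs_neg, abs_mul, abs_mul, abs_two]
      refine mul_le_mul (by linarith) ?_ (abs_nonneg _) (by linarith)
      rw [abs_le]
      constructor <;> linarith

/-- Outside the tube the tangent slope is zero. Inside it no job waits, and the motion of `y` turns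
the drift `2 * (x - y) * (1 - mu * x)` into `-2 * mu * (x - y) ^ 2`, leaving only the jump variance
of order `1 / lam`. -/
theorem cutoffDeriv_add_queueGenerator_ge (hmu : ∀ i, 0 < mu i) (hlam : ∀ i, 0 < lam i)
    {y0 : Fin K → ℝ} (hy0 : ∀ i, 0 ≤ y0 i) {η t : ℝ} (hη : 0 ≤ η) (hη1 : η ≤ 1)
    (hcap : ∑ i, lam i * m i * (max (y0 i) (1 / mu i) + η) ≤ n) (ht : 0 ≤ t)
    (u : List (Fin K)) :
    -(2 * η ^ 2 * ∑ i, (1 + mu i * (max (y0 i) (1 / mu i) + 1)) / lam i) ≤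
      cutoffDeriv lam mu y0 (η ^ 2) t u +
        queueGenerator n m lam mu
          (fun v => cutoff (η ^ 2) (sqDistScaled lam (fluidPath mu y0 t) v)) u := by
  have hY : ∀ i, 0 ≤ max (y0 i) (1 / mu i) := fun i => (hy0 i).trans (le_max_left _ _)
  have hsum : 0 ≤ ∑ i, (1 + mu i * (max (y0 i) (1 / mu i) + 1)) / lam i :=
    Finset.sum_nonneg fun i _ => div_nonneg (add_nonneg zero_le_one (mul_nonneg (hmu i).le
      (add_nonneg (hY i) zero_le_one))) (hlam i).le
  have hgen := queueGenerator_ge_mul (n := n) (m := m) (fun i => (hlam i).le) (fun i => (hmu i).le)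
    (u := u) (g := sqDistScaled lam (fluidPath mu y0 t))
    (fun v => cutoff_sub_ge (η ^ 2) (sqDistScaled lam (fluidPath mu y0 t) u)
      (sqDistScaled lam (fluidPath mu y0 t) v))
  refine le_trans ?_ (add_le_add_right hgen _)
  rw [cutoffDeriv, ← mul_add]
  have h0 : 0 ≤ sqDistScaled lam (fluidPath mu y0 t) u := sqDistScaled_nonneg _ _
  rcases le_or_gt (η ^ 2) (sqDistScaled lam (fluidPath mu y0 t) u) with hle | hlt
  · rw [max_eq_left (by linarith)]
    have := mul_nonneg (sq_nonneg η) hsum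
    simp only [mul_zero, neg_zero, zero_mul]
    linarith
  · have hx : ∀ i, (u.count i : ℝ) / lam i ≤ max (y0 i) (1 / mu i) + η := fun i => by
      have h1 := abs_sub_lt_of_sqDistScaled_lt hη hlt i
      have h2 := (fluidPath_mem hmu hy0 ht i).2
      linarith [(abs_lt.1 h1).2]
    have hu : ∑ i, (u.count i : ℝ) * m i ≤ n := by
      refine le_trans (Finset.sum_le_sum fun i _ => ?_) hcap
      have h1 := (div_le_iff₀ (hlam i)).1 (hx i)
      have h2 := mul_le_mul_of_nonneg_right h1 (Nat.cast_nonneg (α := ℝ) (m i))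
      linarith
    rw [queueGenerator_sqDistScaled hlam _ u hu, ← Finset.sum_add_distrib]
    have hle : ∑ i, (-(2 * ((u.count i : ℝ) / lam i - fluidPath mu y0 t i) *
          (1 - mu i * fluidPath mu y0 t i)) +
        (2 * ((u.count i : ℝ) / lam i - fluidPath mu y0 t i) *
          (1 - mu i * ((u.count i : ℝ) / lam i)) +
          (1 + mu i * ((u.count i : ℝ) / lam i)) / lam i)) ≤
        ∑ i, (1 + mu i * (max (y0 i) (1 / mu i) + 1)) / lam i := by
      refine Finset.sum_le_sum fun i _ => ?_
      have h1 : (1 + mu i * ((u.count i : ℝ) / lam i)) / lam i ≤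
          (1 + mu i * (max (y0 i) (1 / mu i) + 1)) / lam i := by
        refine div_le_div_of_nonneg_right ?_ (hlam i).le
        have := mul_le_mul_of_nonneg_left ((hx i).trans (add_le_add_right hη1 _)) (hmu i).le
        linarith
      have h2 := mul_nonneg (hmu i).le
        (sq_nonneg ((u.count i : ℝ) / lam i - fluidPath mu y0 t i))
      linarith
    rw [max_eq_right (by linarith), neg_mul]
    refine neg_le_neg ((mul_le_mul_of_nonneg_left hle (by linarith)).trans
      (mul_le_mul_of_nonneg_right (by linarith) hsum))

end Drift

/-! ### Probability of leaving the tube -/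

section Concentration

variable {K : ℕ} {n : ℕ} {m : Fin K → ℕ} {lam mu : Fin K → ℝ} {Ω : Type*} {mΩ : MeasurableSpace Ω}
  {P : Measure Ω} [IsProbabilityMeasure P] {F : Filtration ℝ≥0 mΩ} {U : ℝ≥0 → Ω → List (Fin K)}

theorem IsMultiserverJobProcess.mul_measureReal_exists_finset_le
    (hU : IsMultiserverJobProcess n m lam mu P F U) (hm : ∀ i, 0 < m i) (hmu : ∀ i, 0 < mu i)
    (hlam : ∀ i, 0 < lam i) {y0 : Fin K → ℝ} (hy0 : ∀ i, 0 ≤ y0 i) {η : ℝ} (hη : 0 ≤ η)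
    (hη1 : η ≤ 1) (hcap : ∑ i, lam i * m i * (max (y0 i) (1 / mu i) + η) ≤ n) (T : ℝ≥0)
    (S : Finset ℝ≥0) (hS : ∀ q ∈ S, q ≤ T) :
    3 / 4 * (η ^ 2) ^ 2 * P.real {ω | ∃ q ∈ S,
        η ^ 2 / 2 ≤ sqDistScaled lam (fluidPath mu y0 q) (U q ω)} ≤
      ∫ ω, ((η ^ 2) ^ 2 - cutoff (η ^ 2) (sqDistScaled lam y0 (U 0 ω))) ∂P +
        2 * η ^ 2 * (∑ i, (1 + mu i * (max (y0 i) (1 / mu i) + 1)) / lam i) * T := by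
  set δ := η ^ 2 with hδ
  have hδ0 : 0 ≤ δ := sq_nonneg η
  set κ := 2 * δ * ∑ i, (1 + mu i * (max (y0 i) (1 / mu i) + 1)) / lam i with hκ
  have hκ0 : 0 ≤ κ := mul_nonneg (by linarith) (Finset.sum_nonneg fun i _ => div_nonneg
    (add_nonneg zero_le_one (mul_nonneg (hmu i).le (add_nonneg ((hy0 i).trans (le_max_left _ _))
      zero_le_one))) (hlam i).le)
  set φ : ℝ → List (Fin K) → ℝ := fun t u =>
    cutoff δ (sqDistScaled lam (fluidPath mu y0 t) u) with hφ
  have hφ0 : ∀ t u, 0 ≤ φ t u := fun t u => cutoff_nonneg _ _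
  have hφ1 : ∀ t u, φ t u ≤ δ ^ 2 := fun t u => cutoff_le hδ0 (sqDistScaled_nonneg _ _)
  have hφB : ∀ t u, |φ t u| ≤ δ ^ 2 := fun t u => by
    rw [abs_of_nonneg (hφ0 t u)]
    exact hφ1 t u
  -- The term `κ * (T - t)` compensates the worst drift, and it keeps `Z` nonnegative up to time
  -- `T`.
  set Z : ℝ≥0 → Ω → ℝ := fun t ω => δ ^ 2 - φ t (U t ω) + κ * (T - t) with hZ
  have hφi : ∀ t : ℝ≥0, Integrable (fun ω => φ t (U t ω)) P := fun t =>
    hU.integrable_comp (hφB t) t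
  have hZi : ∀ t, Integrable (Z t) P := fun t =>
    ((integrable_const _).sub (hφi t)).add (integrable_const _)
  have hZint : ∀ (t : ℝ≥0) (A : Set Ω),
      ∫ ω in A, Z t ω ∂P = (δ ^ 2 + κ * (T - t)) * P.real A - ∫ ω in A, φ t (U t ω) ∂P := by
    intro t A
    have : ∀ ω, Z t ω = (δ ^ 2 + κ * (T - t)) - φ t (U t ω) := fun ω => by
      simp only [hZ]; ring
    simp_rw [this]
    rw [integral_sub (integrable_const _) (hφi t).integrableOn]
    simp [mul_comm]
  have hmax := mul_measureReal_exists_le_setIntegral (P := P) (F := F) (Z := Z) (T := T)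
    (fun t ht ω => by
      have h1 := mul_nonneg hκ0 (sub_nonneg.2 (NNReal.coe_le_coe.2 ht))
      have h2 := hφ1 t (U t ω)
      simp only [hZ]
      linarith)
    (fun t ε => hU.measurableSet_comp t {u | ε ≤ δ ^ 2 - φ t u + κ * (T - t)})
    hZi
    (fun s t hst _ A hA => by
      have := hU.setIntegral_le_of_generator_ge hm (fun i => (hlam i).le) (fun i => (hmu i).le)
        hφB (fun t u => hasDerivAt_cutoff hmu y0 δ t u)
        (fun t ht u => abs_cutoffDeriv_le hmu hy0 hη ht u)
        (fun t ht u => cutoffDeriv_add_queueGenerator_ge hmu hlam hy0 hη hη1 hcap ht u) hst hA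
      rw [hZint, hZint]
      linarith)
    (3 / 4 * δ ^ 2) S 0 (zero_le) (fun q hq => ⟨zero_le, hS q hq⟩) Set.univ MeasurableSet.univ
  have hsub : {ω | ∃ q ∈ S, δ / 2 ≤ sqDistScaled lam (fluidPath mu y0 q) (U q ω)} ⊆
      Set.univ ∩ {ω | ∃ q ∈ S, 3 / 4 * δ ^ 2 ≤ Z q ω} := by
    rintro ω ⟨q, hq, h⟩
    refine ⟨trivial, q, hq, ?_⟩
    -- At distance `δ / 2` the cutoff is at most `δ ^ 2 / 4`, whence the level `3 / 4 * δ ^ 2` for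
    -- `Z`.
    have h1 : φ q (U q ω) ≤ (δ / 2) ^ 2 :=
      pow_le_pow_left₀ (le_max_left _ _) (max_le (by linarith) (by linarith)) 2
    have h2 := mul_nonneg hκ0 (sub_nonneg.2 (NNReal.coe_le_coe.2 (hS q hq)))
    simp only [hZ]
    linarith
  refine (mul_le_mul_of_nonneg_left (measureReal_mono hsub) (by positivity)).trans
    (hmax.trans (le_of_eq ?_))
  rw [hZint, integral_sub (integrable_const _)
    (by simpa [hφ, fluidPath_zero] using hφi 0)]
  simp [hφ, fluidPath_zero]
  ring

/-- The finite-time bound is uniform, so it passes to a countable dense set of times.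
Right-continuity moves an exit at `t < T` to a nearby later dense time, at the price of halving the
threshold. -/
theorem IsMultiserverJobProcess.measure_exists_le
    (hU : IsMultiserverJobProcess n m lam mu P F U) (hm : ∀ i, 0 < m i) (hmu : ∀ i, 0 < mu i)
    (hlam : ∀ i, 0 < lam i) {y0 : Fin K → ℝ} (hy0 : ∀ i, 0 ≤ y0 i) {η : ℝ} (hη : 0 < η)
    (hη1 : η ≤ 1) (hcap : ∑ i, lam i * m i * (max (y0 i) (1 / mu i) + η) ≤ n) (T : ℝ≥0) :
    P {ω | ∃ t < T, η ^ 2 ≤ sqDistScaled lam (fluidPath mu y0 t) (U t ω)} ≤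
      ENNReal.ofReal ((∫ ω, ((η ^ 2) ^ 2 - cutoff (η ^ 2) (sqDistScaled lam y0 (U 0 ω))) ∂P +
        2 * η ^ 2 * (∑ i, (1 + mu i * (max (y0 i) (1 / mu i) + 1)) / lam i) * T) /
        (3 / 4 * (η ^ 2) ^ 2)) := by
  have hδ : 0 < η ^ 2 := pow_pos hη 2
  set q : ℕ → ℝ≥0 := fun k => min (TopologicalSpace.denseSeq ℝ≥0 k) T with hq
  set E : ℕ → Set Ω := fun N => {ω | ∃ t ∈ (Finset.range N).image q,
    η ^ 2 / 2 ≤ sqDistScaled lam (fluidPath mu y0 t) (U t ω)} with hE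
  have hEmono : Monotone E := by
    rintro a b hab ω ⟨t, ht, h⟩
    exact ⟨t, Finset.image_subset_image (Finset.range_mono hab) ht, h⟩
  have hsub : {ω | ∃ t < T, η ^ 2 ≤ sqDistScaled lam (fluidPath mu y0 t) (U t ω)} ⊆
      ⋃ N, E N := by
    rintro ω ⟨t, htT, ht⟩
    have hcont : Continuous fun s : ℝ≥0 => sqDistScaled lam (fluidPath mu y0 s) (U t ω) := by
      unfold sqDistScaled fluidPath
      fun_prop
    have h1 : ∀ᶠ s : ℝ≥0 in 𝓝[≥] t,
        η ^ 2 / 2 < sqDistScaled lam (fluidPath mu y0 s) (U t ω) :=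
      nhdsWithin_le_nhds ((hcont.tendsto t).eventually_const_lt (by linarith))
    obtain ⟨b, hb, hsb⟩ := (mem_nhdsGE_iff_exists_Ico_subset' htT).1
      (h1.and (hU.right_continuous ω t))
    obtain ⟨_, ⟨k, rfl⟩, hk⟩ := (TopologicalSpace.denseRange_denseSeq ℝ≥0).exists_between
      (lt_min hb htT)
    have hqk : q k = TopologicalSpace.denseSeq ℝ≥0 k := min_eq_left (hk.2.trans_le
      (min_le_right _ _)).le
    obtain ⟨h2, h3⟩ := hsb ⟨hk.1.le, hk.2.trans_le (min_le_left _ _)⟩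
    refine Set.mem_iUnion.2 ⟨k + 1, q k, Finset.mem_image_of_mem _ (Finset.self_mem_range_succ k),
      ?_⟩
    rw [hqk, h3]
    exact h2.le
  refine (measure_mono hsub).trans ?_
  rw [hEmono.measure_iUnion]
  refine iSup_le fun N => ?_
  have hN := hU.mul_measureReal_exists_finset_le hm hmu hlam hy0 hη.le hη1 hcap T
    ((Finset.range N).image q) (fun t ht => by
      obtain ⟨k, _, rfl⟩ := Finset.mem_image.1 ht
      exact min_le_right _ _)
  rw [← ofReal_measureReal]
  refine ENNReal.ofReal_le_ofReal ?_
  rw [le_div_iff₀ (by positivity), mul_comm]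
  exact hN

/-- If all coordinates are within `θ` of `y0`, the integrand is at most `2 * δ` times the squared
distance; otherwise it is at most `δ ^ 2`, and a union bound over classes applies. -/
theorem IsMultiserverJobProcess.integral_initial_le
    (hU : IsMultiserverJobProcess n m lam mu P F U) (y0 : Fin K → ℝ) {δ θ : ℝ} (hδ : 0 ≤ δ) :
    ∫ ω, (δ ^ 2 - cutoff δ (sqDistScaled lam y0 (U 0 ω))) ∂P ≤
      2 * δ * (K * θ ^ 2) +
        δ ^ 2 * ∑ i, P.real {ω | θ ≤ |((U 0 ω).count i : ℝ) / lam i - y0 i|} := by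
  have hms : ∀ i, MeasurableSet {ω | θ ≤ |((U 0 ω).count i : ℝ) / lam i - y0 i|} := fun i =>
    F.le 0 _ (hU.measurableSet_comp 0 {u | θ ≤ |(u.count i : ℝ) / lam i - y0 i|})
  have hind : ∀ i, Integrable (Set.indicator
      {ω | θ ≤ |((U 0 ω).count i : ℝ) / lam i - y0 i|} fun _ => (1 : ℝ)) P := fun i =>
    (integrable_const _).indicator (hms i)
  have hpt : ∀ ω, δ ^ 2 - cutoff δ (sqDistScaled lam y0 (U 0 ω)) ≤ 2 * δ * (K * θ ^ 2) +
      δ ^ 2 * ∑ i, Set.indicator {ω | θ ≤ |((U 0 ω).count i : ℝ) / lam i - y0 i|}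
        (fun _ => (1 : ℝ)) ω := by
    intro ω
    have hi0 : ∀ i, 0 ≤ Set.indicator {ω | θ ≤ |((U 0 ω).count i : ℝ) / lam i - y0 i|}
        (fun _ => (1 : ℝ)) ω := fun i => Set.indicator_nonneg (fun _ _ => zero_le_one) _
    have hK : 0 ≤ 2 * δ * (K * θ ^ 2) := by positivity
    by_cases h : ∃ i, θ ≤ |((U 0 ω).count i : ℝ) / lam i - y0 i|
    · obtain ⟨i, hi⟩ := h
      have h1 : (1 : ℝ) ≤ ∑ i, Set.indicator {ω | θ ≤ |((U 0 ω).count i : ℝ) / lam i - y0 i|}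
          (fun _ => (1 : ℝ)) ω := by
        refine le_trans (le_of_eq ?_) (Finset.single_le_sum (fun i _ => hi0 i) (Finset.mem_univ i))
        simp [Set.indicator, hi]
      have h2 := mul_le_mul_of_nonneg_left h1 (sq_nonneg δ)
      have h3 := cutoff_nonneg δ (sqDistScaled lam y0 (U 0 ω))
      linarith
    · push Not at h
      -- The tangent at 0 has slope `-2 * δ`.
      have h1 := cutoff_sub_ge δ 0 (sqDistScaled lam y0 (U 0 ω))
      have h2 : cutoff δ 0 = δ ^ 2 := by simp [cutoff, hδ]
      rw [h2, sub_zero, sub_zero, max_eq_right hδ] at h1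
      have h3 : sqDistScaled lam y0 (U 0 ω) ≤ K * θ ^ 2 := by
        refine (Finset.sum_le_card_nsmul _ _ (θ ^ 2) fun i _ => ?_).trans (by simp)
        rw [← sq_abs]
        exact pow_le_pow_left₀ (abs_nonneg _) (h i).le 2
      have h4 := mul_le_mul_of_nonneg_left h3 (by linarith : 0 ≤ 2 * δ)
      have h5 := mul_nonneg (sq_nonneg δ) (Finset.sum_nonneg fun i (_ : i ∈ Finset.univ) => hi0 i)
      linarith
  refine (integral_mono ?_ ?_ hpt).trans (le_of_eq ?_)
  · exact (integrable_const _).sub (hU.integrable_comp (B := δ ^ 2) (f := fun u => cutoff δ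
      (sqDistScaled lam y0 u)) (fun u => by
        rw [abs_of_nonneg (cutoff_nonneg _ _)]
        exact cutoff_le hδ (sqDistScaled_nonneg _ _)) 0)
  · exact (integrable_const _).add ((integrable_finsetSum _ fun i _ => hind i).const_mul _)
  · rw [integral_add (integrable_const _) ((integrable_finsetSum _ fun i _ => hind i).const_mul _),
      integral_const_mul (δ ^ 2), integral_finsetSum _ fun i _ => hind i, integral_const,
      probReal_univ, one_smul]
    congr 2
    refine Finset.sum_congr rfl fun i _ => ?_
    rw [integral_indicator_const _ (hms i)]
    simp

end Concentration

/-! ### The fluid equation -/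

section Fluid

variable {K : ℕ} {mu ρ y0 : Fin K → ℝ}

theorem mul_max_le_one_div (hmu : ∀ i, 0 < mu i) (hρ : ∀ i, 0 < ρ i) (hρ_lt : ∑ i, ρ i < 1)
    (hy0 : ∀ i, 0 ≤ y0 i ∧ y0 i < 1 / ((∑ j, ρ j) * mu i)) (i : Fin K) :
    mu i * max (y0 i) (1 / mu i) < 1 / ∑ j, ρ j := by
  have hs : 0 < ∑ j, ρ j := Finset.sum_pos (fun j _ => hρ j) ⟨i, Finset.mem_univ i⟩
  have h1 : mu i * y0 i < 1 / ∑ j, ρ j := by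
    have := mul_lt_mul_of_pos_left (hy0 i).2 (hmu i)
    have hne := (hmu i).ne'
    refine this.trans_eq ?_
    field_simp
  have h2 : mu i * (1 / mu i) < 1 / ∑ j, ρ j := by
    rw [mul_one_div_cancel (hmu i).ne', lt_div_iff₀ hs, one_mul]
    exact hρ_lt
  rcases max_choice (y0 i) (1 / mu i) with h | h <;> rw [h] <;> assumption

/-- Each `mu i * max (y0 i) (1 / mu i)` is below the reciprocal of the total load, and the weights
`ρ i` sum to that load. The strict gap is the spare capacity used for the tube. -/
theorem sum_load_lt_one (hmu : ∀ i, 0 < mu i) (hρ : ∀ i, 0 < ρ i) (hρ_lt : ∑ i, ρ i < 1)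
    (hy0 : ∀ i, 0 ≤ y0 i ∧ y0 i < 1 / ((∑ j, ρ j) * mu i)) :
    ∑ i, ρ i * mu i * max (y0 i) (1 / mu i) < 1 := by
  rcases isEmpty_or_nonempty (Fin K) with h | h
  · simp
  · have hs : 0 < ∑ j, ρ j := Finset.sum_pos (fun j _ => hρ j) Finset.univ_nonempty
    have : ∑ i, ρ i * mu i * max (y0 i) (1 / mu i) < ∑ i, ρ i * (1 / ∑ j, ρ j) := by
      refine Finset.sum_lt_sum_of_nonempty Finset.univ_nonempty fun i _ => ?_
      rw [mul_assoc]
      exact mul_lt_mul_of_pos_left (mul_max_le_one_div hmu hρ hρ_lt hy0 i) (hρ i)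
    rwa [← Finset.sum_mul, mul_one_div_cancel hs.ne'] at this

/-- Since `ρ i` is at most the total load, the path stays below `1 / ρ i` after multiplication by
`mu i`, and the minimum is always its first argument. -/
theorem isFluidSolution_fluidPath (hmu : ∀ i, 0 < mu i) (hρ : ∀ i, 0 < ρ i) (hρ_lt : ∑ i, ρ i < 1)
    (hy0 : ∀ i, 0 ≤ y0 i ∧ y0 i < 1 / ((∑ j, ρ j) * mu i)) :
    IsFluidSolution mu ρ y0 (fluidPath mu y0) := by
  refine ⟨fluidPath_zero y0, fun i t ht => ?_⟩
  have h1 := mul_le_mul_of_nonneg_left (fluidPath_mem hmu (fun i => (hy0 i).1) ht i).2 (hmu i).le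
  have h2 := mul_max_le_one_div hmu hρ hρ_lt hy0 i
  have h3 : 1 / ∑ j, ρ j ≤ 1 / ρ i := one_div_le_one_div_of_le (hρ i)
    (Finset.single_le_sum (fun j _ => (hρ j).le) (Finset.mem_univ i))
  rw [min_eq_left (by linarith)]
  exact (hasDerivAt_fluidPath hmu y0 t i).hasDerivWithinAt

theorem IsFluidSolution.eq_of_nonneg {y z : ℝ → Fin K → ℝ} (hmu : ∀ i, 0 < mu i)
    (hz : IsFluidSolution mu ρ y0 z) (hy : IsFluidSolution mu ρ y0 y) {t : ℝ} (ht : 0 ≤ t) :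
    z t = y t := by
  ext i
  have hlip : LipschitzWith (mu i).toNNReal fun x : ℝ => 1 - min (mu i * x) (1 / ρ i) := by
    refine LipschitzWith.of_dist_le_mul fun a b => ?_
    rw [Real.coe_toNNReal _ (hmu i).le, Real.dist_eq, Real.dist_eq, sub_sub_sub_cancel_left,
      abs_sub_comm, ← abs_of_pos (hmu i), ← abs_mul, mul_sub, abs_of_pos (hmu i)]
    refine (abs_min_sub_min_le_max _ _ _ _).trans ?_
    simp
  have hc : ∀ {x : ℝ → Fin K → ℝ}, IsFluidSolution mu ρ y0 x →
      ContinuousOn (fun s => x s i) (Set.Icc 0 t) := fun hx s hs =>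
    (hx.2 i s hs.1).continuousWithinAt.mono Set.Icc_subset_Ici_self
  have hd : ∀ {x : ℝ → Fin K → ℝ}, IsFluidSolution mu ρ y0 x → ∀ s ∈ Set.Ico 0 t,
      HasDerivWithinAt (fun s => x s i) (1 - min (mu i * x s i) (1 / ρ i)) (Set.Ici s) s :=
    fun hx s hs => (hx.2 i s hs.1).mono (Set.Ici_subset_Ici.2 hs.1)
  exact ODE_solution_unique (fun _ => hlip) (hc hz) (hd hz) (hc hy) (hd hy)
    (by simp only [hz.1, hy.1]) (Set.right_mem_Icc.2 ht)

end Fluid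

/-! ### Passage to the limit -/

/-- Constant load gives `1 / lam = m / (n * ρ * mu)`, which vanishes because `m = o(n)`. -/
theorem tendsto_inv_arrivalRate {K : ℕ} {mu ρ : Fin K → ℝ} (hmu : ∀ i, 0 < mu i)
    (hρ : ∀ i, 0 < ρ i) {m : ℕ → Fin K → ℕ} {lam : ℕ → Fin K → ℝ}
    (hlm : ∀ n, 0 < n → ∀ i, lam n i * m n i = n * (ρ i * mu i))
    (hlam : ∀ n, 0 < n → ∀ i, 0 < lam n i)
    (hm : (fun n => ((Finset.univ.sup (m n) : ℕ) : ℝ)) =o[atTop] (fun n : ℕ => (n : ℝ)))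
    (i : Fin K) : Tendsto (fun n => (lam n i)⁻¹) atTop (𝓝 0) := by
  have h := hm.tendsto_div_nhds_zero.div_const (ρ i * mu i)
  rw [zero_div] at h
  refine squeeze_zero' ?_ ?_ h
  · filter_upwards [eventually_gt_atTop 0] with n hn using (inv_pos.2 (hlam n hn i)).le
  · filter_upwards [eventually_gt_atTop 0] with n hn
    have hn' : (0 : ℝ) < n := Nat.cast_pos.2 hn
    have h1 := mul_pos (hρ i) (hmu i)
    have h2 : (m n i : ℝ) ≤ ((Finset.univ.sup (m n) : ℕ) : ℝ) :=
      Nat.cast_le.2 (Finset.le_sup (f := m n) (Finset.mem_univ i))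
    rw [div_div, le_div_iff₀ (mul_pos hn' h1), ← hlm n hn i, inv_mul_cancel_left₀ (hlam n hn i).ne']
    exact h2

theorem theorem3 {K : ℕ} (mu ρ y0 : Fin K → ℝ)
    (hmu : ∀ i, 0 < mu i) (hρ : ∀ i, 0 < ρ i) (hρ_lt : ∑ i, ρ i < 1)
    (hy0 : ∀ i, 0 ≤ y0 i ∧ y0 i < 1 / ((∑ j, ρ j) * mu i))
    -- server needs and arrival rates of the system with `n` servers
    (m : ℕ → Fin K → ℕ) (lam : ℕ → Fin K → ℝ)
    (hload : ∀ n, 0 < n → ∀ i, classLoad n (lam n i) (m n i) (mu i) = ρ i)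
    (hm : (fun n => ((Finset.univ.sup (m n) : ℕ) : ℝ)) =o[atTop] (fun n : ℕ => (n : ℝ)))
    -- the state process of the system with `n` servers, on its own probability space
    {Ω : ℕ → Type*} {mΩ : ∀ n, MeasurableSpace (Ω n)} (P : ∀ n, Measure (Ω n))
    [∀ n, IsProbabilityMeasure (P n)] (F : ∀ n, Filtration ℝ≥0 (mΩ n))
    (U : ∀ n, ℝ≥0 → Ω n → List (Fin K))
    (hU : ∀ n, 0 < n → IsMultiserverJobProcess n (m n) (lam n) mu (P n) (F n) (U n))
    -- scaled initial numbers of jobs converge in probability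
    (hinit : ∀ i, ∀ ε : ℝ, 0 < ε →
      Tendsto (fun n => P n {ω | ε ≤ |((U n 0 ω).count i : ℝ) / lam n i - y0 i|}) atTop (𝓝 0)) :
    ∃ y : ℝ → Fin K → ℝ,
      IsFluidSolution mu ρ y0 y ∧
      (∀ z, IsFluidSolution mu ρ y0 z → ∀ t, 0 ≤ t → z t = y t) ∧
      Tendsto y atTop (𝓝 (fun i => 1 / mu i)) ∧
      ∀ T : ℝ≥0, 0 < T → ∀ ε : ℝ, 0 < ε →
        Tendsto (fun n => P n {ω | ENNReal.ofReal ε ≤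
          ⨆ t ∈ Set.Icc (0 : ℝ≥0) T,
            ENNReal.ofReal (∑ i, |((U n t ω).count i : ℝ) / lam n i - y t i|)}) atTop (𝓝 0) := by
  have hsol := isFluidSolution_fluidPath hmu hρ hρ_lt hy0
  refine ⟨fluidPath mu y0, hsol, fun z hz t ht => hz.eq_of_nonneg hmu hsol ht,
    tendsto_fluidPath hmu y0, fun T _ ε hε => ?_⟩
  have hy0' : ∀ i, 0 ≤ y0 i := fun i => (hy0 i).1
  have hlm : ∀ n, 0 < n → ∀ i, lam n i * m n i = n * (ρ i * mu i) := fun n hn i => by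
    have h1 := hload n hn i
    have hn' : (0 : ℝ) < n := Nat.cast_pos.2 hn
    rw [classLoad, div_eq_iff (mul_pos hn' (hmu i)).ne'] at h1
    linarith
  have hlm0 : ∀ n, 0 < n → ∀ i, 0 < lam n i * m n i := fun n hn i => by
    rw [hlm n hn i]
    exact mul_pos (Nat.cast_pos.2 hn) (mul_pos (hρ i) (hmu i))
  have hlam : ∀ n, 0 < n → ∀ i, 0 < lam n i := fun n hn i =>
    pos_of_mul_pos_left (hlm0 n hn i) (Nat.cast_nonneg _)
  have hmpos : ∀ n, 0 < n → ∀ i, 0 < m n i := fun n hn i =>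
    Nat.cast_pos.1 (pos_of_mul_pos_right (hlm0 n hn i) (hlam n hn i).le)
  -- The tube radius `η` must keep the total deviation below `ε / 2` and fit in the spare capacity.
  obtain ⟨η, ⟨hη1, hηε, hηcap⟩, hη⟩ : ∃ η : ℝ, (η < 1 ∧ K * η < ε / 2 ∧
      ∑ i, ρ i * mu i * (max (y0 i) (1 / mu i) + η) < 1) ∧ 0 < η := by
    have h1 : ∀ᶠ η in 𝓝 (0 : ℝ), η < 1 := gt_mem_nhds one_pos
    have h2 : ∀ᶠ η in 𝓝 (0 : ℝ), K * η < ε / 2 :=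
      (Continuous.tendsto (by fun_prop) 0).eventually_lt_const (by simpa using hε)
    have h3 : ∀ᶠ η in 𝓝 (0 : ℝ), ∑ i, ρ i * mu i * (max (y0 i) (1 / mu i) + η) < 1 :=
      (Continuous.tendsto (by fun_prop) 0).eventually_lt_const
        (by simpa using sum_load_lt_one hmu hρ hρ_lt hy0)
    exact ((h1.and (h2.and h3)).filter_mono nhdsWithin_le_nhds |>.and
      (self_mem_nhdsWithin : Set.Ioi (0 : ℝ) ∈ 𝓝[>] 0)).exists
  have hδ : 0 < η ^ 2 := pow_pos hη 2
  have hcap : ∀ n, 0 < n → ∑ i, lam n i * m n i * (max (y0 i) (1 / mu i) + η) ≤ n := by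
    intro n hn
    have : ∀ i, lam n i * m n i * (max (y0 i) (1 / mu i) + η) =
        n * (ρ i * mu i * (max (y0 i) (1 / mu i) + η)) := fun i => by
      rw [hlm n hn i]; ring
    simp_rw [this]
    rw [← Finset.mul_sum]
    exact mul_le_of_le_one_right (Nat.cast_nonneg n) hηcap.le
  -- The exit estimate concerns times strictly before its horizon, so horizon `T + 1` is used to
  -- include `T`. The supremum need not preserve strict inequality, so it is bounded by `ε / 2`.
  have hsub : ∀ n, {ω | ENNReal.ofReal ε ≤ ⨆ t ∈ Set.Icc (0 : ℝ≥0) T, ENNReal.ofReal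
        (∑ i, |((U n t ω).count i : ℝ) / lam n i - fluidPath mu y0 t i|)} ⊆
      {ω | ∃ t < T + 1, η ^ 2 ≤ sqDistScaled (lam n) (fluidPath mu y0 t) (U n t ω)} := by
    intro n ω hω
    by_contra hcon
    simp only [Set.mem_ofPred_eq, not_exists, not_and, not_le] at hcon
    refine absurd (le_trans hω (iSup₂_le (a := ENNReal.ofReal (ε / 2)) fun t ht => ?_)) (not_le.2
      ((ENNReal.ofReal_lt_ofReal_iff hε).2 (by linarith)))
    refine ENNReal.ofReal_le_ofReal (le_trans (Finset.sum_le_card_nsmul _ _ η fun i _ => ?_)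
      (by simpa using hηε.le))
    exact (abs_sub_lt_of_sqDistScaled_lt hη.le (hcon t (ht.2.trans_lt (by simp))) i).le
  have hinit0 : Tendsto (fun n => ∫ ω, ((η ^ 2) ^ 2 - cutoff (η ^ 2)
      (sqDistScaled (lam n) y0 (U n 0 ω))) ∂(P n)) atTop (𝓝 0) := by
    refine tendsto_order.2 ⟨fun a ha => Eventually.of_forall fun n => ha.trans_le
      (integral_nonneg fun ω => sub_nonneg.2 (cutoff_le hδ.le (sqDistScaled_nonneg _ _))),
      fun a ha => ?_⟩
    obtain ⟨θ, hθa, hθ⟩ : ∃ θ : ℝ, 2 * η ^ 2 * (K * θ ^ 2) < a ∧ 0 < θ := by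
      have h1 : ∀ᶠ θ in 𝓝 (0 : ℝ), 2 * η ^ 2 * (K * θ ^ 2) < a :=
        (Continuous.tendsto (by fun_prop) 0).eventually_lt_const (by simpa using ha)
      exact (h1.filter_mono nhdsWithin_le_nhds |>.and
        (self_mem_nhdsWithin : Set.Ioi (0 : ℝ) ∈ 𝓝[>] 0)).exists
    have hlim : Tendsto (fun n => 2 * η ^ 2 * (K * θ ^ 2) + (η ^ 2) ^ 2 * ∑ i,
        (P n).real {ω | θ ≤ |((U n 0 ω).count i : ℝ) / lam n i - y0 i|}) atTop
        (𝓝 (2 * η ^ 2 * (K * θ ^ 2) + (η ^ 2) ^ 2 * ∑ _i : Fin K, 0)) :=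
      ((tendsto_finsetSum _ fun i _ => (ENNReal.tendsto_toReal ENNReal.zero_ne_top).comp
        (hinit i θ hθ)).const_mul _).const_add _
    filter_upwards [hlim.eventually_lt_const (by simpa using hθa), eventually_gt_atTop 0]
      with n h1 hn
    exact ((hU n hn).integral_initial_le y0 hδ.le).trans_lt h1
  have hrate : Tendsto (fun n => ∑ i, (1 + mu i * (max (y0 i) (1 / mu i) + 1)) / lam n i) atTop
      (𝓝 (∑ i, (1 + mu i * (max (y0 i) (1 / mu i) + 1)) * 0)) := by
    simp_rw [div_eq_mul_inv]
    exact tendsto_finsetSum _ fun i _ =>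
      (tendsto_inv_arrivalRate hmu hρ hlm hlam hm i).const_mul _
  have hbound := ENNReal.tendsto_ofReal (((hinit0.add
    ((hrate.const_mul (2 * η ^ 2)).mul_const ((T + 1 : ℝ≥0) : ℝ))).div_const
      (3 / 4 * (η ^ 2) ^ 2)))
  simp only [mul_zero, Finset.sum_const_zero, zero_mul, add_zero, zero_div,
    ENNReal.ofReal_zero] at hbound
  refine tendsto_of_tendsto_of_tendsto_of_le_of_le' tendsto_const_nhds hbound
    (Eventually.of_forall fun _ => zero_le) ?_
  filter_upwards [eventually_gt_atTop 0] with n hn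
  exact (measure_mono (hsub n)).trans ((hU n hn).measure_exists_le (hmpos n hn) hmu (hlam n hn)
    hy0' hη hη1.le (hcap n hn) (T + 1))
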